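/- Let $n \ge 0$, let $K$ be a field, and let $P \subset \mathbb{Z}_+^n$ be a discrete polymatroid on $\{1,\dots,n\}$, that is, a nonempty finite set of integer vectors with nonnegative entries such that (i) if $u \in P$, $v \in \mathbb{Z}_+^n$ and $v \le u$ componentwise, then $v \in P$; (ii) if $u, v \in P$ and $|u| < |v|$, where $|u| = u_1 + \cdots + u_n$, then there is $w \in P$ with $u < w \le u \vee v$, where $u \vee v$ is the componentwise maximum and $u<w$ means $u \le w$ and $u \ne w$. Let $\mathcal{P} = \operatorname{conv}(P)$ be the convex hull of $P$ in $\mathbb{R}^n$. In the polynomial ring $K[t_1,\dots,t_n,s]$ write $t^u = t_1^{u_1}\cdots t_n^{u_n}$, let $K[P]$ be the $K$-subalgebra generated by the monomials $t^u s$ with $u \in P$, and let the Ehrhart ring $K[\mathcal{P}]$ be the $K$-subalgebra generated by the monomials $t^u s^i$ such that $(u,i)$ is an integer point of the cone $\{ r(p,1) : r \in \mathbb{R}_{\ge 0},\ p \in \mathcal{P} \} \subset \mathbb{R}^{n+1}$. Then $K[P] = K[\mathcal{P}]$. In particular $K[P]$ is normal, i.e. it is an integral domain that is integrally closed in its field of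 fractions. -/

import Mathlib

namespace DiscPolymatroid

/-- The modulus `|u| = u_1 + ⋯ + u_n` of an integer vector with nonnegative entries. -/
def modulus {n : ℕ} (u : Fin n → ℕ) : ℕ := ∑ i, u i

/-- A discrete polymatroid on the ground set `[n]`: a nonempty finite set of integer vectors with
nonnegative entries which is closed under taking integral subvectors, and such that for all
`u, v ∈ P` with `|u| < |v|` there is `w ∈ P` with `u < w ≤ u ∨ v`. The order and the join are the
componentwise ones (`u < w` means `u ≤ w` and `u ≠ w`). -/
structure IsDiscretePolymatroid {n : ℕ} (P : Set (Fin n → ℕ)) : Prop where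
  nonempty : P.Nonempty
  finite : P.Finite
  mem_of_le : ∀ u ∈ P, ∀ v : Fin n → ℕ, v ≤ u → v ∈ P
  exchange : ∀ u ∈ P, ∀ v ∈ P, modulus u < modulus v → ∃ w ∈ P, u < w ∧ w ≤ u ⊔ v

/-- An integer vector, seen as a real vector. -/
def toReal {n : ℕ} (u : Fin n → ℕ) : Fin n → ℝ := fun i => (u i : ℝ)

/-- The convex hull `conv(P)` of `P` in `ℝⁿ`. -/
def conv {n : ℕ} (P : Set (Fin n → ℕ)) : Set (Fin n → ℝ) := convexHull ℝ (toReal '' P)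

/-- The set `ℝ₊ {(p, 1) : p ∈ PP}` in `ℝⁿ × ℝ`, which is a convex cone when `PP` is convex and
nonempty. -/
def cone {n : ℕ} (PP : Set (Fin n → ℝ)) : Set ((Fin n → ℝ) × ℝ) :=
  {x | ∃ r : ℝ, 0 ≤ r ∧ ∃ p ∈ PP, x = r • (p, (1 : ℝ))}

/-- The polynomial ring `K[t_1, …, t_n, s]`: the variable `t_i` is `X (some i)`, the variable `s`
is `X none`. -/
abbrev PolyRing (n : ℕ) (K : Type*) [Field K] : Type _ := MvPolynomial (Option (Fin n)) K

/-- The monomial `t^u s^k = t_1^{u_1} ⋯ t_n^{u_n} s^k`. -/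
noncomputable def tsMonomial {n : ℕ} (K : Type*) [Field K] (u : Fin n → ℕ) (k : ℕ) :
    PolyRing n K :=
  (∏ i, MvPolynomial.X (some i) ^ u i) * MvPolynomial.X none ^ k

/-- The ring `K[P] = K[t^u s : u ∈ P]`. -/
noncomputable def polymatroidRing {n : ℕ} (K : Type*) [Field K] (P : Set (Fin n → ℕ)) :
    Subalgebra K (PolyRing n K) :=
  Algebra.adjoin K {f | ∃ u ∈ P, f = tsMonomial K u 1}

/-- The Ehrhart ring `K[PP]` of a convex polytope `PP ⊆ ℝ₊ⁿ`: the toric ring generated over `K` by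
the monomials `t^u s^k` such that `(u, k)` is a lattice point of the cone over `PP`. As `PP ⊆ ℝ₊ⁿ`,
all the lattice points of this cone have nonnegative entries. -/
noncomputable def ehrhartRing {n : ℕ} (K : Type*) [Field K] (PP : Set (Fin n → ℝ)) :
    Subalgebra K (PolyRing n K) :=
  Algebra.adjoin K
    {f | ∃ (u : Fin n → ℕ) (k : ℕ), (toReal u, (k : ℝ)) ∈ cone PP ∧ f = tsMonomial K u k}

/-- A commutative ring is a normal domain if it is an integral domain that is integrally closed
in its field of fractions. -/
def IsNormalDomain (R : Type*) [CommRing R] : Prop := IsDomain R ∧ IsIntegrallyClosed R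

end DiscPolymatroid

/-!
Let `ρ(A) = max {u(A) : u ∈ P}` be the rank function of `P`, where `u(A) = ∑ i ∈ A, u i`. The whole
argument runs through the rank inequalities `u(A) ≤ k ρ(A)`, for all `A ⊆ [n]`.

They hold for every integer point `(u, k)` of the cone over `conv P`, because each of them defines
a half-space. Conversely, they force `u` to be a sum of `k` members of `P`:
* for `k = 1` this is `IsDiscretePolymatroid.mem_of_sum_le_rank`, a double application of the
  exchange axiom to a minimal counterexample;
* `ρ` is monotone and submodular (`IsDiscretePolymatroid.rank_submodular`), and a nonnegative
  integer vector dominated by a sum `f + g` of two such functions splits as a vector dominated by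
  `f` plus a vector dominated by `g` (`exists_split`, a discrete sandwich theorem in which one
  coordinate at a time is fixed). With `f = ρ` and `g = k ρ` one member of `P` splits off.

Hence both rings are spanned by the monomials `t^u s^k` subject to the rank inequalities, and they
coincide. For normality, each rank inequality says that a certain integer weight of the monomial is
nonnegative. The polynomials all of whose monomials have nonnegative weight `w` form the preimage of
`K[X][T]` under the map `X_i ↦ X_i T^{w_i}` into the field of fractions of `K[X][T]`; since `K[X][T]`
is integrally closed, a polynomial integral over such a half-space algebra lies in it
(`mem_halfSpaceAlgebra_of_isIntegral`). So `K[P]`, an intersection of half-space algebras, is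
integrally closed in the polynomial ring, which is itself a normal domain.
-/

namespace DiscPolymatroid

/-! ### Splitting integer vectors along submodular functions -/

/-- Monotonicity and submodularity of an integer-valued set function on the subsets of `S`. -/
structure IsMonoSubmodularOn {ι : Type*} [DecidableEq ι] (S : Finset ι) (f : Finset ι → ℤ) :
    Prop where
  mono : ∀ A B, A ⊆ B → B ⊆ S → f A ≤ f B
  submodular : ∀ A B, A ⊆ S → B ⊆ S → f (A ∩ B) + f (A ∪ B) ≤ f A + f B

/-- The constraints `y(A) ≤ f A`, `y(A ∪ {a}) ≤ f (A ∪ {a})` on a vector with prescribed entry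
`y a = c` amount to `y(A) ≤ min (f A) (f (A ∪ {a}) - c)`, which is again monotone and submodular. -/
theorem IsMonoSubmodularOn.fix {ι : Type*} [DecidableEq ι] {S : Finset ι} {f : Finset ι → ℤ}
    {a : ι} (ha : a ∉ S) (hf : IsMonoSubmodularOn (insert a S) f) (c : ℤ) :
    IsMonoSubmodularOn S (fun A => min (f A) (f (insert a A) - c)) := by
  have hins : ∀ A, A ⊆ S → insert a A ⊆ insert a S := fun A hA => Finset.insert_subset_insert a hA
  have hsub : ∀ A, A ⊆ S → A ⊆ insert a S := fun A hA => hA.trans (Finset.subset_insert a S)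
  refine ⟨fun A B hAB hB => ?_, fun A B hA hB => ?_⟩
  · have h1 := hf.mono A B hAB (hsub B hB)
    have h2 := hf.mono _ _ (Finset.insert_subset_insert a hAB) (hins B hB)
    omega
  · have haA : a ∉ A := fun h => ha (hA h)
    have haB : a ∉ B := fun h => ha (hB h)
    have h1 := hf.submodular A B (hsub A hA) (hsub B hB)
    have h2 := hf.submodular _ _ (hins A hA) (hins B hB)
    have h3 := hf.submodular _ _ (hsub A hA) (hins B hB)
    have h4 := hf.submodular _ _ (hins A hA) (hsub B hB)
    rw [← Finset.insert_inter_distrib, ← Finset.insert_union_distrib] at h2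
    rw [Finset.inter_insert_of_notMem haA, Finset.union_insert] at h3
    rw [Finset.insert_inter_of_notMem haB, Finset.insert_union] at h4
    omega

/-- Integer decomposition: a nonnegative integer vector dominated by the sum of two monotone
submodular functions splits into nonnegative integer parts dominated by one function each. The
entries of the first part are chosen one at a time; the normalization at `∅` survives this, and
without it the bounds at `∅` could fail. -/
theorem exists_split {ι : Type*} [DecidableEq ι] (S : Finset ι) :
    ∀ (f g : Finset ι → ℤ) (x : ι → ℤ), IsMonoSubmodularOn S f → IsMonoSubmodularOn S g →
      f ∅ = 0 → g ∅ = 0 → (∀ i, 0 ≤ x i) → (∀ A, A ⊆ S → ∑ i ∈ A, x i ≤ f A + g A) →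
      ∃ y : ι → ℤ, (∀ i, 0 ≤ y i ∧ y i ≤ x i) ∧
        ∀ A, A ⊆ S → ∑ i ∈ A, y i ≤ f A ∧ ∑ i ∈ A, (x i - y i) ≤ g A := by
  induction S using Finset.induction_on with
  | empty =>
    intro f g x _ _ hf0 hg0 hx _
    refine ⟨x, fun i => ⟨hx i, le_rfl⟩, fun A hA => ?_⟩
    rw [Finset.subset_empty.1 hA]
    simp [hf0, hg0]
  | insert a S ha ih =>
    intro f g x hf hg hf0 hg0 hx hfg
    have hins : ∀ A, A ⊆ S → insert a A ⊆ insert a S :=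
      fun A hA => Finset.insert_subset_insert a hA
    have hsub : ∀ A, A ⊆ S → A ⊆ insert a S := fun A hA => hA.trans (Finset.subset_insert a S)
    have hsum : ∀ (z : ι → ℤ) A, A ⊆ S → ∑ i ∈ insert a A, z i = z a + ∑ i ∈ A, z i :=
      fun z A hA => Finset.sum_insert fun h => ha (hA h)
    -- `c` is the least entry at `a` that leaves `g` enough room for the rest of `x`.
    let L : Finset ℤ :=
      insert 0 (S.powerset.image fun B => x a + ∑ i ∈ B, x i - g (insert a B) - f B)
    have hL : L.Nonempty := Finset.insert_nonempty _ _
    obtain ⟨c, hcL, hc⟩ : ∃ c ∈ L, ∀ l ∈ L, l ≤ c :=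
      ⟨L.max' hL, L.max'_mem hL, fun l hl => L.le_max' l hl⟩
    have hc0 : 0 ≤ c := hc 0 (Finset.mem_insert_self _ _)
    have hcB : ∀ B, B ⊆ S → x a + ∑ i ∈ B, x i - g (insert a B) - f B ≤ c := fun B hB =>
      hc _ (Finset.mem_insert_of_mem
        (Finset.mem_image.2 ⟨B, Finset.mem_powerset.2 hB, rfl⟩))
    have hcx : c ≤ x a := by
      rcases Finset.mem_insert.1 hcL with h | h
      · rw [h]; exact hx a
      · obtain ⟨B, hB, rfl⟩ := Finset.mem_image.1 h
        have hB := Finset.mem_powerset.1 hB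
        have h1 := hfg B (hsub B hB)
        have h2 := hg.mono B (insert a B) (Finset.subset_insert a B) (hins B hB)
        omega
    have hcA : ∀ A, A ⊆ S → c ≤ f (insert a A) + g A - ∑ i ∈ A, x i := by
      intro A hA
      rcases Finset.mem_insert.1 hcL with h | h
      · have h1 := hfg A (hsub A hA)
        have h2 := hf.mono A (insert a A) (Finset.subset_insert a A) (hins A hA)
        omega
      · obtain ⟨B, hB, rfl⟩ := Finset.mem_image.1 h
        have hB := Finset.mem_powerset.1 hB
        have haA : a ∉ A := fun h => ha (hA h)
        have haB : a ∉ B := fun h => ha (hB h)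
        -- Uncrossing: `f` on `A ∪ {a}` and `B`, and `g` on `A` and `B ∪ {a}`.
        have h1 := hf.submodular _ _ (hins A hA) (hsub B hB)
        have h2 := hg.submodular _ _ (hsub A hA) (hins B hB)
        rw [Finset.insert_inter_of_notMem haB, Finset.insert_union] at h1
        rw [Finset.inter_insert_of_notMem haA, Finset.union_insert] at h2
        have hU : A ∪ B ⊆ S := Finset.union_subset hA hB
        have h3 := hfg _ (hins _ hU)
        have h4 := hfg (A ∩ B) (hsub _ (Finset.inter_subset_left.trans hA))
        rw [hsum x _ hU] at h3
        have h5 := Finset.sum_union_inter (s₁ := A) (s₂ := B) (f := x)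
        omega
    obtain ⟨y, hy, hyS⟩ := ih _ _ x (hf.fix ha c) (hg.fix ha (x a - c))
      (by have := hcA ∅ (Finset.empty_subset S); simp at this ⊢; omega)
      (by have := hcB ∅ (Finset.empty_subset S); simp at this ⊢; omega) hx
      (fun A hA => by
        have h1 := hfg A (hsub A hA)
        have h2 := hfg _ (hins A hA)
        rw [hsum x A hA] at h2
        have h3 := hcA A hA
        have h4 := hcB A hA
        omega)
    have hne : ∀ i ∈ S, i ≠ a := fun i hi h => ha (h ▸ hi)
    have hS : ∀ A, A ⊆ S → ∑ i ∈ A, Function.update y a c i = ∑ i ∈ A, y i := fun A hA =>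
      Finset.sum_congr rfl fun i hi => Function.update_of_ne (hne i (hA hi)) _ _
    have hS' : ∀ A, A ⊆ S →
        ∑ i ∈ A, (x i - Function.update y a c i) = ∑ i ∈ A, (x i - y i) := fun A hA =>
      Finset.sum_congr rfl fun i hi => by rw [Function.update_of_ne (hne i (hA hi))]
    refine ⟨Function.update y a c, fun i => ?_, fun A hA => ?_⟩
    · rcases eq_or_ne i a with rfl | hi
      · simpa using ⟨hc0, hcx⟩
      · simpa [hi] using hy i
    · by_cases haA : a ∈ A
      · obtain ⟨B, hB, rfl⟩ : ∃ B, B ⊆ S ∧ A = insert a B :=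
          ⟨A.erase a, by rwa [← Finset.subset_insert_iff], (Finset.insert_erase haA).symm⟩
        have h := hyS B hB
        rw [hsum _ B hB, hsum (fun i => x i - Function.update y a c i) B hB, hS B hB, hS' B hB,
          Function.update_self]
        omega
      · have hA' : A ⊆ S := (Finset.subset_insert_iff_of_notMem haA).1 hA
        have h := hyS A hA'
        rw [hS A hA', hS' A hA']
        omega

/-! ### The rank function of a discrete polymatroid -/

/-- The rank function `ρ(A) = max {u(A) : u ∈ P}` of a finite set `P` of integer vectors. -/
noncomputable def rank {n : ℕ} {P : Set (Fin n → ℕ)} (hP : P.Finite) (A : Finset (Fin n)) : ℕ :=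
  hP.toFinset.sup fun u => ∑ i ∈ A, u i

section Rank

variable {n : ℕ} {P : Set (Fin n → ℕ)}

theorem sum_le_rank (hP : P.Finite) {u : Fin n → ℕ} (hu : u ∈ P) (A : Finset (Fin n)) :
    ∑ i ∈ A, u i ≤ rank hP A :=
  Finset.le_sup (f := fun u : Fin n → ℕ => ∑ i ∈ A, u i) (hP.mem_toFinset.2 hu)

theorem rank_empty (hP : P.Finite) : rank hP ∅ = 0 := by
  simp [rank]

theorem rank_mono (hP : P.Finite) {A B : Finset (Fin n)} (hAB : A ⊆ B) :
    rank hP A ≤ rank hP B :=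
  Finset.sup_mono_fun fun _ _ => Finset.sum_le_sum_of_subset hAB

/-- A vector vanishing outside `A` has modulus `u(A)`. -/
theorem modulus_eq_sum {A : Finset (Fin n)} {u : Fin n → ℕ} (hu : ∀ i ∉ A, u i = 0) :
    modulus u = ∑ i ∈ A, u i :=
  (Finset.sum_subset (Finset.subset_univ A) fun i _ hi => hu i hi).symm

theorem modulus_update (u : Fin n → ℕ) (i : Fin n) (c : ℕ) :
    modulus (Function.update u i c) + u i = modulus u + c := by
  have h1 := Finset.sum_update_of_mem (Finset.mem_univ i) u c
  have h2 := Finset.sum_update_of_mem (Finset.mem_univ i) u (u i)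
  rw [Function.update_eq_self] at h2
  unfold modulus
  omega

namespace IsDiscretePolymatroid

variable (hP : IsDiscretePolymatroid P)
include hP

theorem zero_mem : (0 : Fin n → ℕ) ∈ P := by
  obtain ⟨u, hu⟩ := hP.nonempty
  exact hP.mem_of_le u hu 0 fun i => Nat.zero_le _

theorem exists_rank_eq (A : Finset (Fin n)) :
    ∃ u ∈ P, (∀ i ∉ A, u i = 0) ∧ modulus u = rank hP.finite A := by
  obtain ⟨v, hv, hvA⟩ := Finset.exists_mem_eq_sup hP.finite.toFinset
    ⟨0, hP.finite.mem_toFinset.2 hP.zero_mem⟩ fun u => ∑ i ∈ A, u i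
  have h0 : ∀ i ∉ A, (fun i => if i ∈ A then v i else 0) i = 0 := fun i hi => if_neg hi
  refine ⟨fun i => if i ∈ A then v i else 0,
    hP.mem_of_le v (hP.finite.mem_toFinset.1 hv) _ fun i => ?_, h0, ?_⟩
  · dsimp only
    split_ifs <;> simp
  · rw [modulus_eq_sum h0, rank, hvA]
    exact Finset.sum_congr rfl fun i hi => if_pos hi

/-- By the exchange axiom, all maximal members of `P` supported on `A` have modulus `ρ(A)`. -/
theorem exists_extension {A : Finset (Fin n)} {u : Fin n → ℕ} (hu : u ∈ P)
    (huA : ∀ i ∉ A, u i = 0) :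
    ∃ w ∈ P, u ≤ w ∧ (∀ i ∉ A, w i = 0) ∧ modulus w = rank hP.finite A := by
  obtain ⟨w, ⟨hwP, huw, hwA⟩, hmax⟩ := (hP.finite.subset (s := P)
    (t := {w | w ∈ P ∧ u ≤ w ∧ ∀ i ∉ A, w i = 0}) fun w hw => hw.1).exists_maximal
    ⟨u, hu, le_rfl, huA⟩
  refine ⟨w, hwP, huw, hwA, ?_⟩
  by_contra hne
  have hle : modulus w ≤ rank hP.finite A := by
    rw [modulus_eq_sum hwA]
    exact sum_le_rank hP.finite hwP A
  obtain ⟨v, hv, hvA, hvr⟩ := hP.exists_rank_eq A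
  obtain ⟨z, hz, hwz, hzv⟩ := hP.exchange w hwP v hv (by omega)
  refine hwz.not_ge (hmax ⟨hz, huw.trans hwz.le, fun i hi => ?_⟩ hwz.le)
  have := hzv i
  simpa [hwA i hi, hvA i hi] using this

theorem rank_submodular (A B : Finset (Fin n)) :
    rank hP.finite (A ∩ B) + rank hP.finite (A ∪ B) ≤ rank hP.finite A + rank hP.finite B := by
  obtain ⟨u, hu, huA, hur⟩ := hP.exists_rank_eq (A ∩ B)
  obtain ⟨w, hw, huw, hwA, hwr⟩ := hP.exists_extension (A := A ∪ B) hu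
    fun i hi => huA i fun h => hi (Finset.mem_union_left _ (Finset.mem_inter.1 h).1)
  have h1 : modulus u ≤ ∑ i ∈ A ∩ B, w i := by
    rw [modulus_eq_sum huA]
    exact Finset.sum_le_sum fun i _ => huw i
  have h2 := Finset.sum_union_inter (s₁ := A) (s₂ := B) (f := w)
  have h3 := sum_le_rank hP.finite hw A
  have h4 := sum_le_rank hP.finite hw B
  rw [modulus_eq_sum hwA] at hwr
  omega

/-- The rank inequalities cut out `P`. A minimal vector `u` outside `P` satisfying them would have
`u - e_j ∈ P` for all `j` in its support; exchange with a member of `P` of modulus `ρ(supp u)`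
gives `u - e_j + e_i ∈ P`, and exchange of `u - e_i` with the latter gives `u ∈ P`. -/
theorem mem_of_sum_le_rank (u : Fin n → ℕ)
    (hu : ∀ A, ∑ i ∈ A, u i ≤ rank hP.finite A) : u ∈ P := by
  induction u using WellFoundedLT.induction with
  | ind u ih =>
  by_cases hu0 : u = 0
  · exact hu0 ▸ hP.zero_mem
  obtain ⟨j, hj⟩ : ∃ j, u j ≠ 0 := by
    by_contra! h
    exact hu0 (funext h)
  have herase : ∀ i, u i ≠ 0 → Function.update u i (u i - 1) ∈ P := by
    intro i hi
    have hlt : Function.update u i (u i - 1) < u := by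
      rw [update_lt_self_iff]
      omega
    exact ih _ hlt fun A => (Finset.sum_le_sum fun k _ => hlt.le k).trans (hu A)
  have hmod : ∀ i, u i ≠ 0 → modulus (Function.update u i (u i - 1)) + 1 = modulus u := by
    intro i hi
    have := modulus_update u i (u i - 1)
    omega
  let A : Finset (Fin n) := {i | u i ≠ 0}
  have hA : ∀ i ∉ A, u i = 0 := fun i hi => by simpa [A] using hi
  obtain ⟨z, hz, hzA, hzr⟩ := hP.exists_rank_eq A
  have huz : modulus u ≤ modulus z := by
    rw [hzr, modulus_eq_sum hA]
    exact hu A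
  have hmj := hmod j hj
  obtain ⟨w, hw, hvw, hwz⟩ := hP.exchange _ (herase j hj) z hz (by omega)
  obtain ⟨hvw, i, hi⟩ := Pi.lt_def.1 hvw
  by_cases hij : i = j
  · subst hij
    refine hP.mem_of_le w hw u fun k => ?_
    rcases eq_or_ne k i with rfl | hk
    · rw [Function.update_self] at hi
      change u k ≤ w k
      omega
    · simpa [hk] using hvw k
  have hui : u i ≠ 0 := by
    intro h
    have h1 := hwz i
    have h2 := hzA i (by simp [A, h])
    simp [hij, h, h2] at h1 hi
    omega
  -- `x = u - e_j + e_i`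
  let x : Fin n → ℕ := Function.update (Function.update u j (u j - 1)) i (u i + 1)
  have hx : x ∈ P := hP.mem_of_le w hw x fun k => by
    rcases eq_or_ne k i with rfl | hk
    · simp [hij] at hi
      simpa [x] using hi
    · simpa [x, hk] using hvw k
  have hxmod : modulus x = modulus u := by
    have h1 : modulus x + _ = _ := modulus_update (Function.update u j (u j - 1)) i (u i + 1)
    rw [Function.update_of_ne hij] at h1
    omega
  have hmi := hmod i hui
  obtain ⟨y, hy, hvy, hyx⟩ := hP.exchange _ (herase i hui) x hx (by omega)
  obtain ⟨hvy, k, hk⟩ := Pi.lt_def.1 hvy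
  -- Only the entry at `i` can have grown, hence `u ≤ y`.
  have hki : k = i := by
    by_contra hki
    have h1 := hyx k
    rcases eq_or_ne k j with rfl | hkj
    · simp [hki, x] at h1 hk
      omega
    · simp [hki, hkj, x] at h1 hk
      omega
  subst hki
  refine hP.mem_of_le y hy u fun l => ?_
  rcases eq_or_ne l k with rfl | hl
  · rw [Function.update_self] at hk
    change u l ≤ y l
    omega
  · simpa [hl] using hvy l

/-- Every multiple of the rank function of a discrete polymatroid is monotone and submodular. -/
theorem isMonoSubmodularOn_rank (k : ℕ) :
    IsMonoSubmodularOn Finset.univ fun A => (k : ℤ) * rank hP.finite A where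
  mono A B hAB _ := by
    have := rank_mono hP.finite hAB
    gcongr
  submodular A B _ _ := by
    have := hP.rank_submodular A B
    rw [← mul_add, ← mul_add]
    exact mul_le_mul_of_nonneg_left (by exact_mod_cast this) (Nat.cast_nonneg k)

/-- A vector obeying `k + 1` times the rank inequalities is a member of `P` plus a vector obeying
`k` times the rank inequalities. -/
theorem exists_add_eq {k : ℕ} {u : Fin n → ℕ}
    (hu : ∀ A, ∑ i ∈ A, u i ≤ (k + 1) * rank hP.finite A) :
    ∃ v ∈ P, ∃ w : Fin n → ℕ, (∀ A, ∑ i ∈ A, w i ≤ k * rank hP.finite A) ∧ v + w = u := by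
  obtain ⟨y, hy, hyA⟩ := exists_split Finset.univ _ _ (fun i => (u i : ℤ))
    (hP.isMonoSubmodularOn_rank 1) (hP.isMonoSubmodularOn_rank k) (by simp [rank_empty])
    (by simp [rank_empty]) (fun i => by positivity) (fun A _ => by
      have := hu A
      zify at this
      rw [Nat.cast_one]
      linarith)
  have hy1 : ∀ i, ((y i).toNat : ℤ) = y i := fun i => Int.toNat_of_nonneg (hy i).1
  have hy2 : ∀ i, ((u i - (y i).toNat : ℕ) : ℤ) = u i - y i := fun i => by
    have := hy i
    omega
  refine ⟨fun i => (y i).toNat, hP.mem_of_sum_le_rank _ fun A => ?_,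
    fun i => u i - (y i).toNat, fun A => ?_, ?_⟩
  · have := (hyA A (Finset.subset_univ A)).1
    zify
    simp only [hy1]
    simpa using this
  · have := (hyA A (Finset.subset_univ A)).2
    have h : ((∑ i ∈ A, (u i - (y i).toNat) : ℕ) : ℤ) = ∑ i ∈ A, ((u i : ℤ) - y i) := by
      rw [Nat.cast_sum]
      exact Finset.sum_congr rfl fun i _ => hy2 i
    zify at h ⊢
    exact_mod_cast h.trans_le this
  · funext i
    have := hy i
    simp only [Pi.add_apply]
    omega

/-- The cone over `conv P` satisfies the homogenized rank inequalities. -/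
theorem sum_le_of_mem_cone {u : Fin n → ℕ} {k : ℕ} (hu : (toReal u, (k : ℝ)) ∈ cone (conv P))
    (A : Finset (Fin n)) : ∑ i ∈ A, u i ≤ k * rank hP.finite A := by
  obtain ⟨r, hr, p, hp, hup⟩ := hu
  have hpA : ∑ i ∈ A, p i ≤ (rank hP.finite A : ℝ) := by
    have hconv : Convex ℝ {p : Fin n → ℝ | ∑ i ∈ A, p i ≤ (rank hP.finite A : ℝ)} :=
      convex_halfSpace_le ⟨fun p q => by simp [Finset.sum_add_distrib],
        fun c p => by simp [Finset.mul_sum]⟩ _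
    refine convexHull_min ?_ hconv hp
    rintro _ ⟨v, hv, rfl⟩
    have := sum_le_rank hP.finite hv A
    simp only [Set.mem_ofPred_eq, toReal]
    exact_mod_cast this
  have hk : (k : ℝ) = r := by simpa using congrArg Prod.snd hup
  have hui : ∀ i, (u i : ℝ) = r * p i := fun i => by
    simpa [toReal] using congrFun (congrArg Prod.fst hup) i
  have : (∑ i ∈ A, (u i : ℝ)) ≤ k * rank hP.finite A := by
    simp only [hui, ← Finset.mul_sum, hk]
    exact mul_le_mul_of_nonneg_left hpA hr
  exact_mod_cast this

end IsDiscretePolymatroid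

end Rank

/-! ### Half-space subalgebras of a polynomial ring -/

section HalfSpace

open MvPolynomial

variable {σ : Type*} (K : Type*) [Field K] (w : σ → ℤ)

/-- The field of fractions of `K[X_i : i ∈ σ][T]`. -/
abbrev TwistField (σ : Type*) (K : Type*) [Field K] : Type _ :=
  FractionRing (Polynomial (MvPolynomial σ K))

/-- The element `T` of the field of fractions of `K[X_i : i ∈ σ][T]`. -/
noncomputable def twistVar (σ : Type*) (K : Type*) [Field K] : TwistField σ K :=
  algebraMap (Polynomial (MvPolynomial σ K)) _ Polynomial.X

theorem twistVar_ne_zero : twistVar σ K ≠ 0 := by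
  rw [twistVar, Ne, FaithfulSMul.algebraMap_eq_zero_iff]
  exact Polynomial.X_ne_zero

/-- The homomorphism `X_i ↦ X_i T^{w_i}` recording the `w`-weight of a monomial in the exponent
of `T`. -/
noncomputable def twist : MvPolynomial σ K →ₐ[K] TwistField σ K :=
  aeval fun i =>
    algebraMap (Polynomial (MvPolynomial σ K)) _ (Polynomial.C (X i)) * twistVar σ K ^ w i

theorem twist_monomial (m : σ →₀ ℕ) (c : K) :
    twist K w (monomial m c) =
      algebraMap (Polynomial (MvPolynomial σ K)) _ (Polynomial.C (monomial m c)) *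
        twistVar σ K ^ Finsupp.weight w m := by
  induction m using Finsupp.induction_linear generalizing c with
  | zero =>
    simp only [map_zero, zpow_zero, mul_one]
    change twist K w (C c) = algebraMap _ _ (Polynomial.C (C c))
    rw [← algebraMap_eq, AlgHom.commutes]
    rfl
  | add f g hf hg =>
    have h : monomial (f + g) c = monomial f c * monomial g 1 := by simp [monomial_mul]
    rw [h, map_mul, hf, hg, map_mul, map_mul, map_add, zpow_add₀ (twistVar_ne_zero K)]
    ring
  | single i k =>
    have h : monomial (Finsupp.single i k) c = C c * X i ^ k := by
      rw [C_mul_X_pow_eq_monomial]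
    have hC : twist K w (C c) =
        algebraMap (Polynomial (MvPolynomial σ K)) _ (Polynomial.C (C c)) := by
      rw [← algebraMap_eq, AlgHom.commutes]
      rfl
    rw [h, map_mul, map_pow, hC, twist, aeval_X, Finsupp.weight_single, mul_pow, nsmul_eq_mul,
      mul_comm (k : ℤ), zpow_mul, zpow_natCast, map_mul, map_mul, map_pow, map_pow, mul_assoc]

/-- The subalgebra of polynomials whose monomials have nonnegative `w`-weight, encoded as the
preimage of `K[X_i : i ∈ σ][T]` under `X_i ↦ X_i T^{w_i}`. -/
noncomputable def halfSpaceAlgebra : Subalgebra K (MvPolynomial σ K) :=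
  (IsScalarTower.toAlgHom K (Polynomial (MvPolynomial σ K)) (TwistField σ K)).range.comap
    (twist K w)

theorem mem_halfSpaceAlgebra {f : MvPolynomial σ K} :
    f ∈ halfSpaceAlgebra K w ↔
      ∃ g : Polynomial (MvPolynomial σ K), algebraMap _ (TwistField σ K) g = twist K w f :=
  Iff.rfl

theorem monomial_mem_halfSpaceAlgebra {m : σ →₀ ℕ} (hm : 0 ≤ Finsupp.weight w m) (c : K) :
    monomial m c ∈ halfSpaceAlgebra K w := by
  refine (mem_halfSpaceAlgebra K w).2
    ⟨Polynomial.C (monomial m c) * Polynomial.X ^ (Finsupp.weight w m).toNat, ?_⟩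
  rw [twist_monomial, map_mul, map_pow, ← twistVar, ← zpow_natCast, Int.toNat_of_nonneg hm]

theorem weight_nonneg_of_mem_halfSpaceAlgebra {f : MvPolynomial σ K}
    (hf : f ∈ halfSpaceAlgebra K w) {m : σ →₀ ℕ} (hm : m ∈ f.support) :
    0 ≤ Finsupp.weight w m := by
  obtain ⟨g, hg⟩ := (mem_halfSpaceAlgebra K w).1 hf
  -- `T ^ N` clears the negative powers of `T` in the image of `f`.
  let N : ℕ := f.support.sup fun m => (-Finsupp.weight w m).toNat
  have hN : ∀ m ∈ f.support, 0 ≤ N + Finsupp.weight w m := fun m hm => by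
    have : (-Finsupp.weight w m).toNat ≤ N :=
      Finset.le_sup (f := fun m => (-Finsupp.weight w m).toNat) hm
    omega
  have key : Polynomial.X ^ N * g = ∑ m ∈ f.support,
      Polynomial.C (monomial m (coeff m f)) * Polynomial.X ^ (N + Finsupp.weight w m).toNat := by
    apply FaithfulSMul.algebraMap_injective (Polynomial (MvPolynomial σ K)) (TwistField σ K)
    conv_lhs => rw [map_mul, hg, map_pow, ← twistVar, f.as_sum, map_sum, Finset.mul_sum]
    rw [map_sum]
    refine Finset.sum_congr rfl fun m hm => ?_
    rw [twist_monomial, map_mul, map_pow, ← twistVar, ← zpow_natCast, ← zpow_natCast,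
      Int.toNat_of_nonneg (hN m hm), zpow_add₀ (twistVar_ne_zero K)]
    ring
  classical
  by_contra! hlt
  have hj : (N + Finsupp.weight w m).toNat < N := by
    have := hN m hm
    omega
  have h := congrArg (fun p => coeff m (Polynomial.coeff p (N + Finsupp.weight w m).toNat)) key
  simp only [Polynomial.coeff_X_pow_mul', not_le.2 hj, if_false, Polynomial.finsetSum_coeff,
    Polynomial.coeff_C_mul_X_pow, coeff_sum, coeff_zero] at h
  rw [Finset.sum_eq_single m] at h
  · rw [if_pos rfl, coeff_monomial, if_pos rfl] at h
    exact mem_support_iff.1 hm h.symm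
  · intro m' _ hne
    split_ifs
    · rw [coeff_monomial, if_neg hne]
    · rfl
  · exact fun h => absurd hm h

/-- Half-space algebras are integrally closed in the polynomial ring, as `K[X_i : i ∈ σ][T]` is a
unique factorization domain. -/
theorem mem_halfSpaceAlgebra_of_isIntegral {R : Subalgebra K (MvPolynomial σ K)}
    (hR : R ≤ halfSpaceAlgebra K w) {f : MvPolynomial σ K} (hf : IsIntegral R f) :
    f ∈ halfSpaceAlgebra K w := by
  let ι := IsScalarTower.toAlgHom K (Polynomial (MvPolynomial σ K)) (TwistField σ K)
  let e := AlgEquiv.ofInjective ι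
    (FaithfulSMul.algebraMap_injective (Polynomial (MvPolynomial σ K)) (TwistField σ K))
  let φ : R →+* ι.range := ((twist K w).comp R.val).codRestrict ι.range fun r => hR r.2
  have h : IsIntegral (Polynomial (MvPolynomial σ K)) (twist K w f) :=
    hf.map_of_comp_eq ((e.symm : ι.range →+* Polynomial (MvPolynomial σ K)).comp φ)
      (twist K w).toRingHom
      (RingHom.ext fun r => congrArg Subtype.val (e.apply_symm_apply (φ r)))
  exact (mem_halfSpaceAlgebra K w).2 (IsIntegrallyClosed.isIntegral_iff.1 h)

/-- A subalgebra that is integrally closed in an integrally closed domain is a normal domain. -/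
theorem isNormalDomain_of_forall_isIntegral {A : Type*} [CommRing A] [IsDomain A]
    [IsIntegrallyClosed A] [Algebra K A] (R : Subalgebra K A)
    (hR : ∀ f : A, IsIntegral R f → f ∈ R) : IsNormalDomain R := by
  refine ⟨inferInstance, (isIntegrallyClosed_iff (FractionRing R)).2 fun {x} hx => ?_⟩
  have hinj : Function.Injective (algebraMap R A) := Subtype.val_injective
  let ψ : FractionRing R →+* FractionRing A :=
    IsFractionRing.lift (A := R) (K := FractionRing R)
      (g := (algebraMap A (FractionRing A)).comp (algebraMap R A))
      ((FaithfulSMul.algebraMap_injective A (FractionRing A)).comp hinj)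
  have hψ : ∀ r : R, ψ (algebraMap R _ r) = algebraMap A _ (r : A) := fun r =>
    IsFractionRing.lift_algebraMap _ r
  have h1 : IsIntegral R (ψ x) := hx.map_of_comp_eq (RingHom.id R) ψ (RingHom.ext fun r => by
    simp only [RingHom.comp_apply, RingHom.id_apply, hψ]
    rfl)
  obtain ⟨f, hf⟩ := IsIntegrallyClosed.isIntegral_iff.1 (h1.tower_top (A := A))
  rw [← hf, isIntegral_algebraMap_iff (FaithfulSMul.algebraMap_injective A _)] at h1
  exact ⟨⟨f, hR f h1⟩, ψ.injective ((hψ _).trans hf)⟩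

end HalfSpace

/-! ### The ring of a discrete polymatroid -/

section Toric

open MvPolynomial

variable {n : ℕ} (K : Type*) [Field K]

theorem tsMonomial_eq_monomial (m : Option (Fin n) →₀ ℕ) :
    tsMonomial K (fun i => m (some i)) (m none) = monomial m 1 := by
  rw [monomial_eq, map_one, one_mul, Finsupp.prod_fintype _ _ fun _ => pow_zero _,
    Fintype.prod_option, mul_comm]
  rfl

theorem tsMonomial_add (u v : Fin n → ℕ) (k l : ℕ) :
    tsMonomial K (u + v) (k + l) = tsMonomial K u k * tsMonomial K v l := by
  simp only [tsMonomial, Pi.add_apply, pow_add, Finset.prod_mul_distrib]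
  ring

/-- The weight `k ρ(A) - u(A)` of the monomial `t^u s^k`. -/
noncomputable def rankWeight {P : Set (Fin n → ℕ)} (hP : P.Finite) (A : Finset (Fin n)) :
    Option (Fin n) → ℤ
  | none => rank hP A
  | some i => if i ∈ A then -1 else 0

theorem weight_rankWeight {P : Set (Fin n → ℕ)} (hP : P.Finite) (A : Finset (Fin n))
    (m : Option (Fin n) →₀ ℕ) :
    Finsupp.weight (rankWeight hP A) m = m none * (rank hP A : ℤ) - ∑ i ∈ A, (m (some i) : ℤ) := by
  rw [Finsupp.weight_eq_sum, Fintype.sum_option]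
  simp [rankWeight, sub_eq_add_neg]

variable {P : Set (Fin n → ℕ)} (hP : IsDiscretePolymatroid P)
include hP

theorem polymatroidRing_le_halfSpaceAlgebra (A : Finset (Fin n)) :
    polymatroidRing K P ≤ halfSpaceAlgebra K (rankWeight hP.finite A) := by
  refine Algebra.adjoin_le ?_
  rintro _ ⟨u, hu, rfl⟩
  let m : Option (Fin n) →₀ ℕ := Finsupp.equivFunOnFinite.symm fun o => o.elim 1 u
  have hm : tsMonomial K u 1 = monomial m 1 := tsMonomial_eq_monomial K m
  rw [hm]
  refine monomial_mem_halfSpaceAlgebra K _ ?_ 1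
  have h := sum_le_rank hP.finite hu A
  zify at h
  rw [weight_rankWeight]
  simpa [m] using h

/-- Integer decomposition, in terms of monomials. -/
theorem tsMonomial_mem_polymatroidRing {u : Fin n → ℕ} {k : ℕ}
    (hu : ∀ A, ∑ i ∈ A, u i ≤ k * rank hP.finite A) : tsMonomial K u k ∈ polymatroidRing K P := by
  induction k generalizing u with
  | zero =>
    have h0 : ∀ i, u i = 0 := by simpa using hu Finset.univ
    have h1 : tsMonomial K u 0 = 1 := by simp [tsMonomial, h0]
    rw [h1]
    exact one_mem _
  | succ k ih =>
    obtain ⟨v, hv, w, hw, rfl⟩ := hP.exists_add_eq hu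
    rw [add_comm k, tsMonomial_add]
    exact mul_mem (Algebra.subset_adjoin ⟨v, hv, rfl⟩) (ih hw)

theorem polymatroidRing_eq_ehrhartRing : polymatroidRing K P = ehrhartRing K (conv P) := by
  refine le_antisymm (Algebra.adjoin_mono ?_) (Algebra.adjoin_le ?_)
  · rintro _ ⟨u, hu, rfl⟩
    refine ⟨u, 1, ⟨1, zero_le_one, toReal u, subset_convexHull ℝ _ ⟨u, hu, rfl⟩, ?_⟩, rfl⟩
    rw [one_smul, Nat.cast_one]
  · rintro _ ⟨u, k, hu, rfl⟩
    exact tsMonomial_mem_polymatroidRing K hP (hP.sum_le_of_mem_cone hu)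

theorem mem_polymatroidRing_of_isIntegral {f : PolyRing n K}
    (hf : IsIntegral (polymatroidRing K P) f) : f ∈ polymatroidRing K P := by
  rw [f.as_sum]
  refine sum_mem fun m hm => ?_
  have h : monomial m (coeff m f) =
      coeff m f • tsMonomial K (fun i => m (some i)) (m none) := by
    rw [tsMonomial_eq_monomial, smul_monomial, smul_eq_mul, mul_one]
  rw [h]
  refine Subalgebra.smul_mem _ (tsMonomial_mem_polymatroidRing K hP fun A => ?_) _
  have hA := weight_nonneg_of_mem_halfSpaceAlgebra K _
    (mem_halfSpaceAlgebra_of_isIntegral K _ (polymatroidRing_le_halfSpaceAlgebra K hP A) hf) hm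
  rw [weight_rankWeight, sub_nonneg] at hA
  exact_mod_cast hA

end Toric

end DiscPolymatroid

theorem theorem6p1 {n : ℕ} (K : Type*) [Field K] (P : Set (Fin n → ℕ))
    (hP : DiscPolymatroid.IsDiscretePolymatroid P) :
    DiscPolymatroid.polymatroidRing K P =
        DiscPolymatroid.ehrhartRing K (DiscPolymatroid.conv P) ∧
      DiscPolymatroid.IsNormalDomain (DiscPolymatroid.polymatroidRing K P) :=
  ⟨DiscPolymatroid.polymatroidRing_eq_ehrhartRing K hP,
    DiscPolymatroid.isNormalDomain_of_forall_isIntegral K _ fun _ =>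
      DiscPolymatroid.mem_polymatroidRing_of_isIntegral K hP⟩
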